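/- Fix integers $n,p,K\ge 1$ (numbers of workers, firms, and types on each side), worker types $k_1,\dots,k_n\in\{1,\dots,K\}$ and firm types $\ell_1,\dots,\ell_p\in\{1,\dots,K\}$, all non-random. Let $n_k$ be the number of workers of type $k$ and assume $n_k\ge 1$ for every $k$. Let $\theta_j\ge 0$ satisfy $\sum_{j:\ell_j=\ell}\theta_j=1$ for every type $\ell$, and let $C\in\mathbb R^{K\times K}$ have nonnegative entries, with $p_{ij}:=\frac{1}{n_{k_i}}\theta_j C(k_i,\ell_j)\le 1$ for all $i,j$. Let $B=(d_{ij})$ be a random $n\times p$ matrix with independent entries $d_{ij}\sim\mathrm{Bernoulli}(p_{ij})$, and let $\mathfrak B=(p_{ij})=\mathbb E B$. Let $\lambda_w,\lambda_f\ge 0$. For an $n\times p$ matrix $A$ put $D_{w,\lambda}(A)=\mathrm{diag}\big(\sum_j A_{ij}+\lambda_w\big)_{i}$, $D_{f,\lambda}(A)=\mathrm{diag}\big(\sum_i A_{ij}+\lambda_f\big)_{j}$, $E_\lambda(A)=D_{w,\lambda}(A)^{-1/2}\,A\,D_{f,\lambda}(A)^{-1/2}$, $L_{w,\lambda}(A)=I_n-E_\lambda(A)E_\lambda(A)^\top$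 and $L_{f,\lambda}(A)=I_p-E_\lambda(A)^\top E_\lambda(A)$. Write $E_\lambda,L_{w,\lambda},L_{f,\lambda}$ for these matrices at $A=B$, and $\mathfrak E_\lambda,\mathfrak L_{w,\lambda},\mathfrak L_{f,\lambda}$ for the same matrices at $A=\mathfrak B$. Let $\|\cdot\|$ be the spectral norm. Let $\underline\delta_w=\min_k \frac1{n_k}\sum_{\ell}C(k,\ell)$ and $\underline\delta_f=\min_j\theta_j\sum_k C(k,\ell_j)$ be the minimum expected worker and firm degrees, assume $\underline\delta_w+\lambda_w>0$ and $\underline\delta_f+\lambda_f>0$, and let $$M=\max\big((\underline\delta_w+\lambda_w)^{-1},(\underline\delta_f+\lambda_f)^{-1}\big),\qquad \gamma=p/n .$$ Let $\epsilon>0$ and assume $M\le\big(3\ln\frac{n+p}{\epsilon}\big)^{-1}$. Put $t=\sqrt{3M\ln\frac{n+p}{\epsilon}}$. Then $t\le 1$ and, with probability at least $1-\frac{3+4\gamma}{1+\gamma}\epsilon$, all of the following hold simultaneously: the diagonal entries of $D_{w,\lambda}(B)$ and $D_{f,\lambda}(B)$ are positive (so that $E_\lambda$, $L_{w,\lambda}$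 and $L_{f,\lambda}$ are well defined), and $$\|E_\lambda-\mathfrak E_\lambda\|\le 4t,\qquad \|L_{w,\lambda}-\mathfrak L_{w,\lambda}\|\le 8t,\qquad \|L_{f,\lambda}-\mathfrak L_{f,\lambda}\|\le 8t .$$ -/

import Mathlib

open MeasureTheory ProbabilityTheory
open scoped Matrix Matrix.Norms.L2Operator

namespace BipartiteSBM

noncomputable section

/-! ### Regularized degrees, normalized matrices and Laplacians of a weighted bipartite graph

Throughout, `B` is the weighted adjacency matrix, with rows indexed by `n` workers and columns
indexed by `p` firms. Matrix norms are spectral norms (`Matrix.Norms.L2Operator`). -/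

section Laplacians

variable {n p : ℕ}

/-- The degree `d_{i·}` of worker `i`. -/
def workerDegree (B : Matrix (Fin n) (Fin p) ℝ) (i : Fin n) : ℝ := ∑ j, B i j

/-- The degree `d_{·j}` of firm `j`. -/
def firmDegree (B : Matrix (Fin n) (Fin p) ℝ) (j : Fin p) : ℝ := ∑ i, B i j

/-- `D_{w,λ}^{-1/2}`, where `D_{w,λ} = diag(d_{i·} + λ_w)`. It is meaningful when all the
regularized worker degrees are positive. -/
def workerScaling (lw : ℝ) (B : Matrix (Fin n) (Fin p) ℝ) : Matrix (Fin n) (Fin n) ℝ :=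
  Matrix.diagonal fun i => (√(workerDegree B i + lw))⁻¹

/-- `D_{f,λ}^{-1/2}`, where `D_{f,λ} = diag(d_{·j} + λ_f)`. It is meaningful when all the
regularized firm degrees are positive. -/
def firmScaling (lf : ℝ) (B : Matrix (Fin n) (Fin p) ℝ) : Matrix (Fin p) (Fin p) ℝ :=
  Matrix.diagonal fun j => (√(firmDegree B j + lf))⁻¹

/-- The normalized regularized bipartite matrix `E_λ = D_{w,λ}^{-1/2} B D_{f,λ}^{-1/2}`. -/
def normalized (lw lf : ℝ) (B : Matrix (Fin n) (Fin p) ℝ) : Matrix (Fin n) (Fin p) ℝ :=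
  workerScaling lw B * B * firmScaling lf B

/-- The regularized worker Laplacian `L_{w,λ} = I_n - E_λ E_λᵀ`. -/
def workerLaplacian (lw lf : ℝ) (B : Matrix (Fin n) (Fin p) ℝ) : Matrix (Fin n) (Fin n) ℝ :=
  1 - normalized lw lf B * (normalized lw lf B)ᵀ

/-- The regularized firm Laplacian `L_{f,λ} = I_p - E_λᵀ E_λ`. -/
def firmLaplacian (lw lf : ℝ) (B : Matrix (Fin n) (Fin p) ℝ) : Matrix (Fin p) (Fin p) ℝ :=
  1 - (normalized lw lf B)ᵀ * normalized lw lf B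

/-- All the regularized degrees are positive, i.e. the diagonal matrices `D_{w,λ}` and `D_{f,λ}`
are positive definite, so that `E_λ` and the two Laplacians are well defined. -/
def WellDefined (lw lf : ℝ) (B : Matrix (Fin n) (Fin p) ℝ) : Prop :=
  (∀ i, 0 < workerDegree B i + lw) ∧ ∀ j, 0 < firmDegree B j + lf

end Laplacians

/-! ### The degree-corrected stochastic block model -/

/-- The parameters of the model with `n` workers, `p` firms and `K` types on each side.
Types are given (non-random), and every worker type occurs. -/
structure BlockModel (n p K : ℕ) where
  /-- the type `k_i` of worker `i` -/
  workerType : Fin n → Fin K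
  /-- the type `ℓ_j` of firm `j` -/
  firmType : Fin p → Fin K
  /-- the degree parameter `θ_j` of firm `j` -/
  θ : Fin p → ℝ
  /-- the affinity matrix `C` -/
  C : Matrix (Fin K) (Fin K) ℝ
  workerType_surjective : Function.Surjective workerType
  θ_nonneg : ∀ j, 0 ≤ θ j
  /-- the `θ_j` sum to one within each firm type -/
  θ_sum : ∀ l, ∑ j with firmType j = l, θ j = 1
  C_nonneg : ∀ k l, 0 ≤ C k l
  /-- the edge probabilities `p_{ij} = θ_j C(k_i, ℓ_j) / n_{k_i}` are at most one -/
  prob_le_one : ∀ i j,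
    1 / ((Finset.univ.filter fun i' => workerType i' = workerType i).card : ℝ) * θ j *
      C (workerType i) (firmType j) ≤ 1

namespace BlockModel

variable {n p K : ℕ} (m : BlockModel n p K)

/-- `n_k`, the number of workers of type `k`. -/
def typeCount (k : Fin K) : ℕ := (Finset.univ.filter fun i => m.workerType i = k).card

/-- The matrix of edge probabilities `p_{ij} = θ_j C(k_i, ℓ_j) / n_{k_i}`, which is the
expectation of the random weighted adjacency matrix. -/
def expectedMatrix : Matrix (Fin n) (Fin p) ℝ := fun i j =>
  1 / (m.typeCount (m.workerType i) : ℝ) * m.θ j * m.C (m.workerType i) (m.firmType j)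

theorem expectedMatrix_mem (i : Fin n) (j : Fin p) :
    m.expectedMatrix i j ∈ unitInterval :=
  ⟨mul_nonneg (mul_nonneg (by positivity) (m.θ_nonneg j)) (m.C_nonneg _ _), m.prob_le_one i j⟩

/-- The minimum expected worker degree `min_k C(k,·) / n_k`, where `C(k,·) = ∑_ℓ C(k,ℓ)`. -/
def minWorkerDegree : ℝ := ⨅ k, 1 / (m.typeCount k : ℝ) * ∑ l, m.C k l

/-- The minimum expected firm degree `min_j θ_j C(·,ℓ_j)`, where `C(·,ℓ) = ∑_k C(k,ℓ)`. -/
def minFirmDegree : ℝ := ⨅ j, m.θ j * ∑ k, m.C k (m.firmType j)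

/-- `B` is a random adjacency matrix of the model: its entries `d_{ij}` are independent, and
`d_{ij}` equals `1` with probability `p_{ij}` and `0` with probability `1 - p_{ij}`. -/
structure IsNetwork {Ω : Type*} [MeasurableSpace Ω] (μ : Measure Ω)
    (B : Ω → Matrix (Fin n) (Fin p) ℝ) : Prop where
  indep : iIndepFun (fun (e : Fin n × Fin p) ω => B ω e.1 e.2) μ
  law : ∀ i j, HasLaw (fun ω => B ω i j)
    (bernoulliMeasure (1 : ℝ) 0 ⟨m.expectedMatrix i j, m.expectedMatrix_mem i j⟩) μ

end BlockModel

end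

end BipartiteSBM

/-! With A the expected matrix, E(B) - E(A) splits into two parts. The centred part keeps the
deterministic scalings of A; its entries are independent, and a matrix Bernstein inequality bounds
its norm by t outside an event of probability ε. The other part changes only the scalings. Scalar
Chernoff bounds put every regularized degree within relative error t of its mean, so this part is
entrywise at most t E(B), and a Schur test bounds its norm by t. Hence ‖E(B) - E(A)‖ ≤ 2t. Both
normalized matrices have norm at most 1, so the Laplacians differ by at most 4t.

The choice t² = 3ML, with L = ln((n+p)/ε), makes each exponential tail at most ε/(n+p). The degrees
cost 2ε and the matrix bound ε, 3ε in all.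

Bernstein rests on the Golden–Thompson inequality, itself obtained from trace inequalities for
powers 2^k and the Lie–Trotter formula. Each entry is encoded by two orthogonal rank-one
projections, so its matrix exponential is explicit and only scalar Bernoulli estimates remain. -/

namespace BipartiteSBM

/-! ### Trace inequalities for powers of products -/

section TraceInequalities

open Matrix

variable {d : Type*} [Fintype d]

theorem two_mul_trace_mul_le (A B : Matrix d d ℝ) :
    2 * (A * B).trace ≤ (A * Aᵀ).trace + (B * Bᵀ).trace := by
  have h : (B * Bᵀ).trace = (Bᵀ * B).trace := trace_mul_comm _ _
  rw [h]
  simp only [trace, diag, mul_apply, transpose_apply, Finset.mul_sum, ← Finset.sum_add_distrib]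
  exact Finset.sum_le_sum fun i _ => Finset.sum_le_sum fun j _ => by
    nlinarith [sq_nonneg (A i j - B j i)]

variable [DecidableEq d]

theorem trace_mul_pow_comm (A B : Matrix d d ℝ) (k : ℕ) :
    ((A * B) ^ k).trace = ((B * A) ^ k).trace := by
  cases k with
  | zero => simp
  | succ k =>
    have h : SemiconjBy A ((B * A) ^ k) ((A * B) ^ k) :=
      SemiconjBy.pow_right (by simp [SemiconjBy, mul_assoc]) k
    rw [pow_succ, pow_succ, ← mul_assoc, ← h.eq, mul_assoc, trace_mul_comm, mul_assoc]

/-- The two claims feed each other. For the first, apply it at level k to X²: cyclicity turns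
X²(X²)ᵀ into (XXᵀ)(XᵀX), the second claim separates the factors, and `two_mul_trace_mul_le`
recombines them. For the second, apply the first to PQ and rotate PQ²P into P²Q². -/
theorem trace_pow_two_pow_le (k : ℕ) :
    (∀ X : Matrix d d ℝ, (X ^ 2 ^ (k + 1)).trace ≤ ((X * Xᵀ) ^ 2 ^ k).trace) ∧
    ∀ P Q : Matrix d d ℝ, P.IsSymm → Q.IsSymm →
      ((P * Q) ^ 2 ^ k).trace ≤ (P ^ 2 ^ k * Q ^ 2 ^ k).trace := by
  induction k with
  | zero =>
    refine ⟨fun X => ?_, fun P Q _ _ => by simp⟩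
    have := two_mul_trace_mul_le X X
    simp only [zero_add, pow_one, pow_zero, pow_two]
    linarith
  | succ k ih =>
    obtain ⟨ihT, ihU⟩ := ih
    constructor
    · intro X
      have hP : (Xᵀ * X).IsSymm := by simp [IsSymm, transpose_mul]
      have hQ : (X * Xᵀ).IsSymm := by simp [IsSymm, transpose_mul]
      have h1 := ihT (X ^ 2)
      have e1 : X ^ 2 * (X ^ 2)ᵀ = X * (X * Xᵀ * Xᵀ) := by
        simp [pow_two, transpose_mul, mul_assoc]
      have e2 : X * Xᵀ * Xᵀ * X = (X * Xᵀ) * (Xᵀ * X) := by simp [mul_assoc]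
      rw [e1, trace_mul_pow_comm, e2] at h1
      have h2 := ihU _ _ hQ hP
      have h3 := two_mul_trace_mul_le ((X * Xᵀ) ^ 2 ^ k) ((Xᵀ * X) ^ 2 ^ k)
      rw [(hQ.pow _).eq, (hP.pow _).eq, ← pow_add, ← pow_add, trace_mul_pow_comm Xᵀ X,
        ← two_mul (2 ^ k), ← pow_succ'] at h3
      rw [← pow_mul, ← pow_succ'] at h1
      linarith
    · intro P Q hP hQ
      have h1 := ihT (P * Q)
      have e1 : P * Q * (P * Q)ᵀ = (P * Q ^ 2) * P := by
        rw [transpose_mul, hP.eq, hQ.eq]; simp [pow_two, mul_assoc]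
      have e2 : P * (P * Q ^ 2) = P ^ 2 * Q ^ 2 := by simp [pow_two, mul_assoc]
      rw [e1, trace_mul_pow_comm (P * Q ^ 2), e2] at h1
      have h2 := ihU _ _ (hP.pow 2) (hQ.pow 2)
      rw [← pow_mul, ← pow_mul, ← pow_succ'] at h2
      exact h1.trans h2

end TraceInequalities

/-! ### The Lie–Trotter product formula -/

section LieTrotter

open NormedSpace Filter Topology

variable {𝔸 : Type*} [NormedRing 𝔸]

theorem norm_pow_sub_pow_le [NormOneClass 𝔸] {X Y : 𝔸} {c : ℝ} (hc : 1 ≤ c) (hX : ‖X‖ ≤ c)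
    (hY : ‖Y‖ ≤ c) (m : ℕ) : ‖X ^ m - Y ^ m‖ ≤ m * c ^ m * ‖X - Y‖ := by
  induction m with
  | zero => simp
  | succ m ih =>
    have h : X ^ (m + 1) - Y ^ (m + 1) = X ^ m * (X - Y) + (X ^ m - Y ^ m) * Y := by
      rw [pow_succ, pow_succ]; noncomm_ring
    have hXm : ‖X ^ m‖ ≤ c ^ (m + 1) :=
      ((norm_pow_le X m).trans (pow_le_pow_left₀ (norm_nonneg _) hX m)).trans
        (pow_le_pow_right₀ hc (Nat.le_succ m))
    calc ‖X ^ (m + 1) - Y ^ (m + 1)‖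
        ≤ ‖X ^ m‖ * ‖X - Y‖ + ‖X ^ m - Y ^ m‖ * ‖Y‖ := by
          rw [h]; exact (norm_add_le _ _).trans (add_le_add (norm_mul_le _ _) (norm_mul_le _ _))
      _ ≤ c ^ (m + 1) * ‖X - Y‖ + m * c ^ m * ‖X - Y‖ * c := by gcongr
      _ = _ := by push_cast; ring

variable [NormedAlgebra ℝ 𝔸]

theorem norm_exp_le_exp_norm [NormOneClass 𝔸] (A : 𝔸) : ‖exp A‖ ≤ Real.exp ‖A‖ := by
  rw [exp_eq_tsum ℝ, Real.exp_eq_exp_ℝ]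
  refine tsum_of_norm_bounded (exp_series_hasSum_exp' (𝕂 := ℝ) ‖A‖) fun k => ?_
  rw [norm_smul, norm_inv, RCLike.norm_natCast, smul_eq_mul]
  gcongr
  exact norm_pow_le A k

theorem tendsto_exp_mul_exp_pow [CompleteSpace 𝔸] [NormOneClass 𝔸] (A B : 𝔸) :
    Tendsto (fun m : ℕ => (exp ((m : ℝ)⁻¹ • A) * exp ((m : ℝ)⁻¹ • B)) ^ m) atTop
      (𝓝 (exp (A + B))) := by
  let : NormedAlgebra ℚ 𝔸 := NormedAlgebra.restrictScalars ℚ ℝ 𝔸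
  -- The two exponential curves agree to first order at 0, so at s = 1/m they differ by o(1/m).
  have hd : HasDerivAt (fun s : ℝ => exp (s • (A + B)) - exp (s • A) * exp (s • B)) 0 0 := by
    have h1 := hasDerivAt_exp_smul_const (𝕂 := ℝ) (A + B) 0
    have h2 := (hasDerivAt_exp_smul_const (𝕂 := ℝ) A 0).mul
      (hasDerivAt_exp_smul_const (𝕂 := ℝ) B 0)
    refine (h1.sub h2).congr_deriv ?_
    simp
  have hlim : Tendsto (fun m : ℕ => (m : ℝ) *
      ‖exp ((m : ℝ)⁻¹ • (A + B)) - exp ((m : ℝ)⁻¹ • A) * exp ((m : ℝ)⁻¹ • B)‖) atTop (𝓝 0) := by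
    have h := hasDerivAt_iff_isLittleO.1 hd
    simp only [zero_smul, exp_zero, mul_one, sub_self, sub_zero, smul_zero] at h
    have hinv : Tendsto (fun m : ℕ => (m : ℝ)⁻¹) atTop (𝓝 0) := tendsto_inv_atTop_nhds_zero_nat
    have h' := (h.comp_tendsto hinv).norm_left.tendsto_div_nhds_zero
    refine h'.congr fun m => ?_
    simp [mul_comm]
  -- Telescoping with c = exp((‖A‖ + ‖B‖)/m): the factor c^m does not depend on m.
  have hb : ∀ m : ℕ, 0 < m →
      ‖(exp ((m : ℝ)⁻¹ • A) * exp ((m : ℝ)⁻¹ • B)) ^ m - exp (A + B)‖ ≤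
      Real.exp (‖A‖ + ‖B‖) * ((m : ℝ) *
      ‖exp ((m : ℝ)⁻¹ • (A + B)) - exp ((m : ℝ)⁻¹ • A) * exp ((m : ℝ)⁻¹ • B)‖) := by
    intro m hm
    have hm' : (m : ℝ) ≠ 0 := by positivity
    have e : exp (A + B) = exp ((m : ℝ)⁻¹ • (A + B)) ^ m := by
      rw [← exp_nsmul, ← Nat.cast_smul_eq_nsmul ℝ, smul_smul, mul_inv_cancel₀ hm', one_smul]
    have hn : ∀ C : 𝔸, ‖(m : ℝ)⁻¹ • C‖ = (m : ℝ)⁻¹ * ‖C‖ := fun C => by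
      rw [norm_smul]; simp
    have hX : ‖exp ((m : ℝ)⁻¹ • (A + B))‖ ≤ Real.exp ((m : ℝ)⁻¹ * (‖A‖ + ‖B‖)) :=
      (norm_exp_le_exp_norm _).trans (Real.exp_le_exp.2 (by
        rw [hn]; gcongr; exact norm_add_le _ _))
    have hY : ‖exp ((m : ℝ)⁻¹ • A) * exp ((m : ℝ)⁻¹ • B)‖ ≤
        Real.exp ((m : ℝ)⁻¹ * (‖A‖ + ‖B‖)) := by
      rw [mul_add, Real.exp_add, ← hn, ← hn]
      exact (norm_mul_le _ _).trans (mul_le_mul (norm_exp_le_exp_norm _)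
        (norm_exp_le_exp_norm _) (norm_nonneg _) (Real.exp_pos _).le)
    have h := norm_pow_sub_pow_le (Real.one_le_exp (by positivity)) hX hY m
    rw [← Real.exp_nat_mul, mul_inv_cancel_left₀ hm', ← e, norm_sub_rev] at h
    linarith
  rw [tendsto_iff_norm_sub_tendsto_zero]
  refine squeeze_zero' (Eventually.of_forall fun _ => norm_nonneg _)
    ((eventually_gt_atTop 0).mono hb) ?_
  simpa using hlim.const_mul (Real.exp (‖A‖ + ‖B‖))

end LieTrotter

/-! ### The Golden–Thompson inequality -/

section GoldenThompson

open Matrix NormedSpace Filter Topology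

variable {d : Type*} [Fintype d] [DecidableEq d]

/-- The **Golden–Thompson inequality** for real symmetric matrices. -/
theorem trace_exp_add_le {A B : Matrix d d ℝ} (hA : A.IsSymm) (hB : B.IsSymm) :
    (exp (A + B)).trace ≤ (exp A * exp B).trace := by
  cases isEmpty_or_nonempty d with
  | inl _ => simp [trace]
  | inr _ =>
  -- Only exponents 2^k are covered by the trace inequality, so the limit is taken along them.
  have hlim := (tendsto_exp_mul_exp_pow A B).comp (tendsto_pow_atTop_atTop_of_one_lt one_lt_two)
  have htr : Continuous fun X : Matrix d d ℝ => X.trace := by fun_prop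
  refine le_of_tendsto ((htr.tendsto _).comp hlim) (Eventually.of_forall fun k => ?_)
  have h := (trace_pow_two_pow_le k).2 (exp (((2 ^ k : ℕ) : ℝ)⁻¹ • A))
    (exp (((2 ^ k : ℕ) : ℝ)⁻¹ • B)) (IsSymm.exp (hA.smul _)) (IsSymm.exp (hB.smul _))
  have e : ∀ C : Matrix d d ℝ, exp (((2 ^ k : ℕ) : ℝ)⁻¹ • C) ^ 2 ^ k = exp C := fun C => by
    rw [← Matrix.exp_nsmul, ← Nat.cast_smul_eq_nsmul ℝ, smul_smul,
      mul_inv_cancel₀ (by positivity), one_smul]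
  rw [e, e] at h
  exact h

end GoldenThompson

/-! ### Exponentials of symmetric matrices and projections -/

section MatrixExponential

open Matrix NormedSpace

variable {d : Type*} [Fintype d] [DecidableEq d]

theorem continuous_matrix_exp : Continuous (exp : Matrix d d ℝ → Matrix d d ℝ) := by
  let : NormedAlgebra ℚ (Matrix d d ℝ) := NormedAlgebra.restrictScalars ℚ ℝ _
  exact NormedSpace.exp_continuous

theorem exp_smul_of_isIdempotentElem {P : Matrix d d ℝ} (hP : IsIdempotentElem P) (a : ℝ) :
    exp (a • P) = 1 + (Real.exp a - 1) • P := by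
  have h1 : HasSum (fun k : ℕ => ((k.factorial : ℝ)⁻¹ • a ^ k) • P) (Real.exp a • P) := by
    rw [Real.exp_eq_exp_ℝ]
    exact (exp_series_hasSum_exp' (𝕂 := ℝ) a).smul_const P
  -- Every positive power of P is P; the correction 1 - P accounts for the zeroth power.
  have h2 : HasSum (fun k : ℕ => if k = 0 then 1 - P else 0) (1 - P) :=
    hasSum_ite_eq 0 (1 - P)
  have h3 := exp_series_hasSum_exp' (𝕂 := ℝ) (a • P)
  have h4 : (fun k : ℕ => (k.factorial : ℝ)⁻¹ • (a • P) ^ k) =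
      fun k : ℕ => ((k.factorial : ℝ)⁻¹ • a ^ k) • P + if k = 0 then 1 - P else 0 := by
    funext k
    cases k with
    | zero => simp
    | succ k => rw [smul_pow, hP.pow_succ_eq]; simp [smul_smul]
  rw [h4] at h3
  rw [h3.unique (h1.add h2), sub_smul, one_smul]
  abel

theorem exp_smul_add_smul {P Q : Matrix d d ℝ} (hP : IsIdempotentElem P)
    (hQ : IsIdempotentElem Q) (hPQ : P * Q = 0) (hQP : Q * P = 0) (a b : ℝ) :
    exp (a • P + b • Q) = 1 + (Real.exp a - 1) • P + (Real.exp b - 1) • Q := by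
  have hc : Commute (a • P) (b • Q) := by simp [Commute, SemiconjBy, hPQ, hQP]
  rw [Matrix.exp_add_of_commute _ _ hc, exp_smul_of_isIdempotentElem hP,
    exp_smul_of_isIdempotentElem hQ]
  simp [add_mul, mul_add, hPQ]

theorem posSemidef_exp {A : Matrix d d ℝ} (hA : A.IsSymm) : (exp A).PosSemidef := by
  have h : exp A = (exp ((2 : ℝ)⁻¹ • A))ᴴ * exp ((2 : ℝ)⁻¹ • A) := by
    rw [conjTranspose_eq_transpose_of_trivial, (IsSymm.exp (hA.smul _)).eq,
      ← Matrix.exp_add_of_commute _ _ (Commute.refl _), ← add_smul]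
    norm_num
  rw [h]
  exact posSemidef_conjTranspose_mul_self _

/-- The quadratic form at a unit vector is at most the largest eigenvalue, whose exponential is one
of the positive terms summing to the trace. -/
theorem exp_dotProduct_mulVec_le_trace_exp {A : Matrix d d ℝ} (hA : A.IsSymm) {v : d → ℝ}
    (hv : v ⬝ᵥ v = 1) : Real.exp (v ⬝ᵥ A *ᵥ v) ≤ (exp A).trace := by
  have hH : A.IsHermitian := by
    rwa [IsHermitian, conjTranspose_eq_transpose_of_trivial]
  have hne : Nonempty d := by
    by_contra h
    rw [not_nonempty_iff] at h
    simp at hv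
  obtain ⟨U, hU⟩ : ∃ U : Matrix d d ℝ, U = hH.eigenvectorUnitary := ⟨_, rfl⟩
  have hUU : U * Uᵀ = 1 := by
    have := Unitary.coe_mul_star_self hH.eigenvectorUnitary
    rwa [Unitary.coe_star, ← hU, star_eq_conjTranspose,
      conjTranspose_eq_transpose_of_trivial] at this
  have hUU' : Uᵀ * U = 1 := mul_eq_one_comm.1 hUU
  have hdec : A = U * diagonal hH.eigenvalues * Uᵀ := by
    have := hH.spectral_theorem
    rw [Unitary.conjStarAlgAut_apply, ← hU, star_eq_conjTranspose,
      conjTranspose_eq_transpose_of_trivial] at this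
    exact this
  have hinv : U⁻¹ = Uᵀ := inv_eq_right_inv hUU
  have htr : (exp A).trace = ∑ i, Real.exp (hH.eigenvalues i) := by
    conv_lhs => rw [hdec, ← hinv, exp_conj _ _ (IsUnit.of_mul_eq_one _ hUU), hinv,
      trace_mul_comm, ← mul_assoc, hUU', one_mul, exp_diagonal, trace_diagonal]
    simp [Real.exp_eq_exp_ℝ]
  obtain ⟨i, hi⟩ := Finite.exists_max hH.eigenvalues
  have hq : v ⬝ᵥ A *ᵥ v = ∑ j, hH.eigenvalues j * (Uᵀ *ᵥ v) j ^ 2 := by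
    conv_lhs => rw [hdec, ← mulVec_mulVec, ← mulVec_mulVec, dotProduct_mulVec,
      ← mulVec_transpose]
    simp only [dotProduct, mulVec_diagonal]
    exact Finset.sum_congr rfl fun j _ => by ring
  have hw : ∑ j, (Uᵀ *ᵥ v) j ^ 2 = 1 := by
    rw [← hv]
    have : (Uᵀ *ᵥ v) ⬝ᵥ (Uᵀ *ᵥ v) = v ⬝ᵥ v := by
      rw [dotProduct_mulVec, vecMul_transpose, mulVec_mulVec, hUU, one_mulVec]
    rw [← this]
    simp [dotProduct, pow_two]
  have hle : v ⬝ᵥ A *ᵥ v ≤ hH.eigenvalues i := by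
    rw [hq, ← mul_one (hH.eigenvalues i), ← hw, Finset.mul_sum]
    exact Finset.sum_le_sum fun j _ => mul_le_mul_of_nonneg_right (hi j) (sq_nonneg _)
  rw [htr]
  exact (Real.exp_le_exp.2 hle).trans
    (Finset.single_le_sum (f := fun i => Real.exp (hH.eigenvalues i))
      (fun j _ => (Real.exp_pos _).le) (Finset.mem_univ i))

end MatrixExponential

/-! ### Matrix Laplace transforms of independent sums -/

section Independence

open Matrix NormedSpace

variable {Ω : Type*} [MeasurableSpace Ω] {μ : Measure Ω} [IsProbabilityMeasure μ]

/-- Almost surely the variables lie in a compact cube, on which f is bounded. -/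
theorem integrable_continuous_comp {κ : Type*} [Fintype κ] {Y : κ → Ω → ℝ}
    (hm : ∀ k, AEMeasurable (Y k) μ) (hb : ∀ k, ∀ᵐ ω ∂μ, Y k ω ∈ Set.Icc (0 : ℝ) 1)
    {f : (κ → ℝ) → ℝ} (hf : Continuous f) : Integrable (fun ω => f fun k => Y k ω) μ := by
  obtain ⟨c, hc⟩ := (isCompact_univ_pi fun _ : κ => isCompact_Icc (a := (0 : ℝ)) (b := 1)
    ).exists_bound_of_continuousOn hf.continuousOn
  refine Integrable.of_bound
    (hf.measurable.comp_aemeasurable (aemeasurable_pi_lambda _ hm)).aestronglyMeasurable c ?_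
  filter_upwards [ae_all_iff.2 hb] with ω hω
  exact hc _ fun k _ => hω k

variable {d : Type*} [Fintype d] [DecidableEq d]

/-- Matrix Laplace transform bound: if each summand satisfies `𝔼 exp (X e) ≤ 1` in the Loewner
order, then the trace exponential of the sum has expectation at most the dimension. -/
theorem integral_trace_exp_sum_le {ι : Type*} [DecidableEq ι] {Y : ι → Ω → ℝ}
    (hind : iIndepFun Y μ) (hm : ∀ e, AEMeasurable (Y e) μ)
    (hb : ∀ e, ∀ᵐ ω ∂μ, Y e ω ∈ Set.Icc (0 : ℝ) 1) {X : ι → ℝ → Matrix d d ℝ}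
    (hX : ∀ e, Continuous (X e)) (hsymm : ∀ e x, (X e x).IsSymm)
    (hstep : ∀ e, ∀ W : Matrix d d ℝ, W.PosSemidef →
      ∫ ω, (W * exp (X e (Y e ω))).trace ∂μ ≤ W.trace) (S : Finset ι) :
    ∫ ω, (exp (∑ e ∈ S, X e (Y e ω))).trace ∂μ ≤ Fintype.card d := by
  induction S using Finset.induction_on with
  | empty => simp
  | insert e S he ih =>
    have hcS : Continuous fun y : S → ℝ => exp (∑ i : S, X i (y i)) :=
      continuous_matrix_exp.comp (continuous_finsetSum _ fun i _ =>
        (hX i).comp (continuous_apply i))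
    have hce : Continuous fun x : ℝ => exp (X e x) := continuous_matrix_exp.comp (hX e)
    have hcS' : ∀ a b, Continuous fun y : S → ℝ => exp (∑ i : S, X i (y i)) a b :=
      fun a b => hcS.matrix_elem a b
    have hce' : ∀ a b, Continuous fun x : ℝ => exp (X e x) a b := fun a b => hce.matrix_elem a b
    have hsumS : ∀ ω, ∑ i ∈ S, X i (Y i ω) = ∑ i : S, X i (Y i ω) := fun ω =>
      (Finset.sum_coe_sort S fun i => X i (Y i ω)).symm
    have hsS : ∀ ω, (∑ i ∈ S, X i (Y i ω)).IsSymm := fun ω => by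
      rw [IsSymm, transpose_sum]
      exact Finset.sum_congr rfl fun i _ => hsymm i _
    have hintS : ∀ a b, Integrable (fun ω => exp (∑ i ∈ S, X i (Y i ω)) a b) μ := fun a b => by
      simp only [hsumS]
      exact integrable_continuous_comp (Y := fun i : S => Y i) (fun i => hm i) (fun i => hb i)
        (hcS' a b)
    have hinte : ∀ a b, Integrable (fun ω => exp (X e (Y e ω)) a b) μ := fun a b =>
      integrable_continuous_comp (κ := Unit) (Y := fun _ => Y e) (fun _ => hm e) (fun _ => hb e)
        (f := fun y => exp (X e (y ())) a b) ((hce' a b).comp (continuous_apply _))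
    have hindep : ∀ a b, IndepFun (fun ω => exp (∑ i ∈ S, X i (Y i ω)) a b)
        (fun ω => exp (X e (Y e ω)) b a) μ := fun a b => by
      simp only [hsumS]
      have h := hind.indepFun_finset₀ S {e} (by simpa using he) hm
      exact h.comp (φ := fun y : S → ℝ => exp (∑ i : S, X i (y i)) a b)
        (ψ := fun y : ({e} : Finset ι) → ℝ => exp (X e (y ⟨e, by simp⟩)) b a)
        (hcS' a b).measurable (((hce' b a).comp (continuous_apply _)).measurable)
    -- N is the entrywise mean of the new factor; independence allows it to replace that factor
    -- under the integral.
    obtain ⟨N, hN⟩ : ∃ N : Matrix d d ℝ, N = Matrix.of fun a b => ∫ ω, exp (X e (Y e ω)) a b ∂μ :=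
      ⟨_, rfl⟩
    have htrace : ∀ W : Matrix d d ℝ, (W * N).trace = ∫ ω, (W * exp (X e (Y e ω))).trace ∂μ := by
      intro W
      simp only [trace, diag, mul_apply, hN, Matrix.of_apply]
      refine ((integral_finsetSum _ fun a _ => integrable_finsetSum _ fun b _ =>
        (hinte b a).const_mul (W a b)).trans (Finset.sum_congr rfl fun a _ => ?_)).symm
      refine (integral_finsetSum _ fun b _ => (hinte b a).const_mul (W a b)).trans ?_
      simp only [integral_const_mul]
    have hprod : ∀ a b, ∫ ω, exp (∑ i ∈ S, X i (Y i ω)) a b * exp (X e (Y e ω)) b a ∂μ =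
        ∫ ω, exp (∑ i ∈ S, X i (Y i ω)) a b * N b a ∂μ := fun a b => by
      rw [integral_mul_const, hN, Matrix.of_apply]
      exact (hindep a b).integral_mul_eq_mul_integral (hintS a b).1 (hinte b a).1
    have hintprod : ∀ a b, Integrable
        (fun ω => exp (∑ i ∈ S, X i (Y i ω)) a b * exp (X e (Y e ω)) b a) μ := fun a b =>
      (hindep a b).integrable_mul (hintS a b) (hinte b a)
    have hctr : Integrable (fun ω => (exp (∑ i ∈ insert e S, X i (Y i ω))).trace) μ := by
      have : ∀ ω, ∑ i ∈ insert e S, X i (Y i ω) = ∑ i : (insert e S : Finset ι), X i (Y i ω) :=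
        fun ω => (Finset.sum_coe_sort _ fun i => X i (Y i ω)).symm
      simp only [this]
      refine integrable_continuous_comp (Y := fun i : (insert e S : Finset ι) => Y i)
        (fun i => hm i) (fun i => hb i)
        (f := fun y => (exp (∑ i : (insert e S : Finset ι), X i (y i))).trace) ?_
      have hc : Continuous fun y : ↥(insert e S) → ℝ =>
          exp (∑ i : (insert e S : Finset ι), X i (y i)) :=
        continuous_matrix_exp.comp (continuous_finsetSum _ fun i _ =>
          (hX i).comp (continuous_apply i))
      exact hc.matrix_trace
    have hintS' : Integrable (fun ω => (exp (∑ i ∈ S, X i (Y i ω))).trace) μ :=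
      integrable_finsetSum _ fun a _ => hintS a a
    calc ∫ ω, (exp (∑ i ∈ insert e S, X i (Y i ω))).trace ∂μ
        ≤ ∫ ω, (exp (∑ i ∈ S, X i (Y i ω)) * exp (X e (Y e ω))).trace ∂μ := by
          refine integral_mono hctr ?_ fun ω => ?_
          · simp only [trace, diag, mul_apply]
            exact integrable_finsetSum _ fun a _ => integrable_finsetSum _ fun b _ =>
              hintprod a b
          · simp only [Finset.sum_insert he]
            rw [add_comm]
            exact trace_exp_add_le (hsS ω) (hsymm e _)
      _ = ∫ ω, (exp (∑ i ∈ S, X i (Y i ω)) * N).trace ∂μ := by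
          simp only [trace, diag, mul_apply]
          rw [integral_finsetSum _ fun a _ => integrable_finsetSum _ fun b _ => hintprod a b,
            integral_finsetSum _ fun a _ => integrable_finsetSum _ fun b _ =>
              (hintS a b).mul_const _]
          refine Finset.sum_congr rfl fun a _ => ?_
          rw [integral_finsetSum _ fun b _ => hintprod a b,
            integral_finsetSum _ fun b _ => (hintS a b).mul_const _]
          exact Finset.sum_congr rfl fun b _ => hprod a b
      _ ≤ ∫ ω, (exp (∑ i ∈ S, X i (Y i ω))).trace ∂μ := by
          refine integral_mono ?_ hintS' fun ω => ?_
          · simp only [trace, diag, mul_apply]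
            exact integrable_finsetSum _ fun a _ => integrable_finsetSum _ fun b _ =>
              (hintS a b).mul_const _
          · simp only [htrace]
            exact hstep e _ (posSemidef_exp (hsS ω))
      _ ≤ _ := ih

end Independence

/-! ### Quadratic forms, spectral norms and rank-one projections -/

section MatrixTools

open Matrix NormedSpace

theorem exp_le_trace_exp_of_lt {d : Type*} [Fintype d] [DecidableEq d] {A : Matrix d d ℝ}
    (hA : A.IsSymm) {v : d → ℝ} {c : ℝ} (hv : c * (v ⬝ᵥ v) < v ⬝ᵥ A *ᵥ v) :
    Real.exp c ≤ (exp A).trace := by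
  have hpos : 0 < v ⬝ᵥ v := by
    refine lt_of_le_of_ne (Finset.sum_nonneg fun i _ => mul_self_nonneg _) fun h => ?_
    rw [eq_comm, dotProduct_self_eq_zero] at h
    simp [h] at hv
  have hs : √(v ⬝ᵥ v) ^ 2 = v ⬝ᵥ v := Real.sq_sqrt hpos.le
  have hs0 : √(v ⬝ᵥ v) ≠ 0 := (Real.sqrt_pos.2 hpos).ne'
  have h := exp_dotProduct_mulVec_le_trace_exp hA (v := (√(v ⬝ᵥ v))⁻¹ • v) (by
    rw [smul_dotProduct, dotProduct_smul, smul_eq_mul, smul_eq_mul]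
    nth_rewrite 3 [← hs]
    field_simp)
  refine le_trans (Real.exp_le_exp.2 ?_) h
  rw [mulVec_smul, smul_dotProduct, dotProduct_smul, smul_eq_mul, smul_eq_mul, ← mul_assoc,
    ← mul_inv, ← pow_two, hs, ← div_eq_inv_mul, le_div_iff₀ hpos]
  exact hv.le

theorem l2_opNorm_le_of_forall {I J : Type*} [Fintype I] [Fintype J] [DecidableEq J]
    {Z : Matrix I J ℝ} {t : ℝ} (ht : 0 < t)
    (h : ∀ (y : I → ℝ) (x : J → ℝ), 2 * (y ⬝ᵥ Z *ᵥ x) ≤ t * (y ⬝ᵥ y + x ⬝ᵥ x)) : ‖Z‖ ≤ t := by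
  rw [l2_opNorm_def]
  refine ContinuousLinearMap.opNorm_le_bound _ ht.le fun x => ?_
  -- The choice y = Zx/t is optimal for fixed x and turns the bilinear bound into ‖Zx‖² ≤ t²‖x‖².
  have hx := h (t⁻¹ • Z *ᵥ x.ofLp) x.ofLp
  simp only [smul_dotProduct, dotProduct_smul, smul_eq_mul] at hx
  have hsq : Z *ᵥ x.ofLp ⬝ᵥ Z *ᵥ x.ofLp ≤ t ^ 2 * (x.ofLp ⬝ᵥ x.ofLp) := by
    have e : t * (t⁻¹ * (t⁻¹ * (Z *ᵥ x.ofLp ⬝ᵥ Z *ᵥ x.ofLp)) + x.ofLp ⬝ᵥ x.ofLp) =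
        t⁻¹ * (Z *ᵥ x.ofLp ⬝ᵥ Z *ᵥ x.ofLp) + t * (x.ofLp ⬝ᵥ x.ofLp) := by
      field_simp
    rw [e] at hx
    have h2 : t⁻¹ * (Z *ᵥ x.ofLp ⬝ᵥ Z *ᵥ x.ofLp) ≤ t * (x.ofLp ⬝ᵥ x.ofLp) := by linarith
    rw [inv_mul_le_iff₀ ht] at h2
    linarith
  refine le_of_sq_le_sq ?_ (by positivity)
  rw [mul_pow, EuclideanSpace.norm_sq_eq, EuclideanSpace.norm_sq_eq]
  simpa [dotProduct, pow_two, mul_assoc] using hsq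

/-- The projection-like rank-one matrix `u uᵀ / 2`. -/
noncomputable def halfOuter {d : Type*} (u : d → ℝ) : Matrix d d ℝ := (2 : ℝ)⁻¹ • vecMulVec u u

variable {d : Type*}

theorem halfOuter_isSymm (u : d → ℝ) : (halfOuter u).IsSymm := by
  simp [halfOuter, IsSymm, transpose_vecMulVec]

variable [Fintype d]

theorem halfOuter_mul (u w : d → ℝ) :
    halfOuter u * halfOuter w = ((2 : ℝ)⁻¹ * 2⁻¹ * (u ⬝ᵥ w)) • vecMulVec u w := by
  simp [halfOuter, vecMulVec_mul_vecMulVec, smul_smul, vecMulVec_smul, mul_assoc]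

theorem dotProduct_halfOuter_mulVec (u v : d → ℝ) :
    v ⬝ᵥ halfOuter u *ᵥ v = 2⁻¹ * (u ⬝ᵥ v) ^ 2 := by
  rw [halfOuter, smul_mulVec, vecMulVec_mulVec, dotProduct_smul, dotProduct_smul,
    dotProduct_comm v u]
  simp [pow_two]

theorem trace_mul_halfOuter_nonneg {W : Matrix d d ℝ} (hW : W.PosSemidef) (u : d → ℝ) :
    0 ≤ (W * halfOuter u).trace := by
  have h := hW.dotProduct_mulVec_nonneg u
  rw [halfOuter, Matrix.mul_smul, trace_smul, mul_vecMulVec, trace_vecMulVec, dotProduct_comm]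
  simpa using h

variable [DecidableEq d]

theorem exp_halfOuter_add {u w : d → ℝ} (hu : u ⬝ᵥ u = 2) (hw : w ⬝ᵥ w = 2) (huw : u ⬝ᵥ w = 0)
    (a b : ℝ) : exp (a • halfOuter u + b • halfOuter w) =
      1 + (Real.exp a - 1) • halfOuter u + (Real.exp b - 1) • halfOuter w := by
  refine exp_smul_add_smul ?_ ?_ ?_ ?_ a b
  · rw [IsIdempotentElem, halfOuter_mul, hu, halfOuter]; norm_num
  · rw [IsIdempotentElem, halfOuter_mul, hw, halfOuter]; norm_num
  · rw [halfOuter_mul, huw]; simp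
  · rw [halfOuter_mul, dotProduct_comm, huw]; simp

end MatrixTools

/-! ### Bernoulli moment generating functions and Chernoff bounds -/

section Bernoulli

variable {Ω : Type*} [MeasurableSpace Ω] {μ : Measure Ω}

/-- The cubic Taylor remainder gives 1/2 + (2/9)(2/3) < 3/4. The range 2/3 is what the later optimal
parameters 2t/3 need when t ≤ 1. -/
theorem exp_sub_one_sub_le {z : ℝ} (hz : |z| ≤ 2 / 3) :
    Real.exp z - 1 - z ≤ 3 / 4 * z ^ 2 := by
  have h := (abs_le.1 (Real.exp_bound (hz.trans (by norm_num)) (n := 3) (by norm_num))).2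
  simp only [Finset.sum_range_succ, Finset.sum_range_zero, Nat.factorial] at h
  have h3 : |z| ^ 3 = z ^ 2 * |z| := by rw [pow_succ, sq_abs]
  rw [h3] at h
  norm_num at h
  nlinarith [mul_le_mul_of_nonneg_left hz (sq_nonneg z)]

theorem bernoulli_mgf_le {q z : ℝ} (hq : q ∈ unitInterval) (hz : |z| ≤ 2 / 3) :
    q * Real.exp (z * (1 - q)) + (1 - q) * Real.exp (z * (0 - q)) ≤
      Real.exp (3 / 4 * z ^ 2 * q) := by
  have h1 : q * Real.exp (z * (1 - q)) + (1 - q) * Real.exp (z * (0 - q)) =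
      Real.exp (-(z * q)) * (q * (Real.exp z - 1) + 1) := by
    have : z * (1 - q) = -(z * q) + z := by ring
    rw [this, Real.exp_add, show z * (0 - q) = -(z * q) by ring]
    ring
  rw [h1]
  calc Real.exp (-(z * q)) * (q * (Real.exp z - 1) + 1)
      ≤ Real.exp (-(z * q)) * Real.exp (q * (Real.exp z - 1)) := by
        gcongr; exact Real.add_one_le_exp _
    _ = Real.exp (q * (Real.exp z - 1 - z)) := by rw [← Real.exp_add]; ring_nf
    _ ≤ _ := Real.exp_le_exp.2 (by
        nlinarith [mul_le_mul_of_nonneg_left (exp_sub_one_sub_le hz) hq.1])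

theorem integral_comp_of_hasLaw_bernoulli {Y : Ω → ℝ} {q : unitInterval}
    (hY : HasLaw Y (bernoulliMeasure (1 : ℝ) 0 q) μ) {f : ℝ → ℝ} (hf : Continuous f) :
    ∫ ω, f (Y ω) ∂μ = q * f 1 + (1 - q) * f 0 := by
  have h := hY.integral_comp (f := f) hf.aestronglyMeasurable
  rw [integral_bernoulliMeasure] at h
  simpa [Function.comp_def] using h

theorem ae_eq_zero_or_one_of_hasLaw_bernoulli {Y : Ω → ℝ} {q : unitInterval}
    (hY : HasLaw Y (bernoulliMeasure (1 : ℝ) 0 q) μ) : ∀ᵐ ω ∂μ, Y ω = 0 ∨ Y ω = 1 := by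
  have hms : MeasurableSet {x : ℝ | ¬(x = 0 ∨ x = 1)} :=
    ((measurableSet_singleton 0).union (measurableSet_singleton 1)).compl
  rw [ae_iff, hY.measure_eq (p := fun x => ¬(x = 0 ∨ x = 1)) hms]
  classical
  rw [bernoulliMeasure_apply _ hms]
  simp

theorem ae_mem_Icc_of_hasLaw_bernoulli {Y : Ω → ℝ} {q : unitInterval}
    (hY : HasLaw Y (bernoulliMeasure (1 : ℝ) 0 q) μ) : ∀ᵐ ω ∂μ, Y ω ∈ Set.Icc (0 : ℝ) 1 := by
  filter_upwards [ae_eq_zero_or_one_of_hasLaw_bernoulli hY] with ω hω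
  rcases hω with h | h <;> simp [h]

/-- Chernoff bound for the sum of independent Bernoulli variables. -/
theorem measure_abs_sum_sub_ge_le [IsProbabilityMeasure μ] {ι : Type*} {Y : ι → Ω → ℝ}
    (hind : iIndepFun Y μ) {q : ι → unitInterval}
    (hlaw : ∀ e, HasLaw (Y e) (bernoulliMeasure (1 : ℝ) 0 (q e)) μ) (S : Finset ι) {D t : ℝ}
    (hD : ∑ e ∈ S, (q e : ℝ) ≤ D) (ht0 : 0 ≤ t) (ht1 : t ≤ 1) :
    μ.real {ω | t * D ≤ |∑ e ∈ S, Y e ω - ∑ e ∈ S, (q e : ℝ)|} ≤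
      2 * Real.exp (-(t ^ 2 * D / 3)) := by
  obtain ⟨X, hX⟩ : ∃ X : ι → Ω → ℝ, X = fun e ω => Y e ω - q e := ⟨_, rfl⟩
  have hXind : iIndepFun X μ := by
    rw [hX]; exact hind.comp (fun e x => x - (q e : ℝ)) fun e => by fun_prop
  have hXm : ∀ e, AEMeasurable (X e) μ := fun e => by
    rw [hX]; exact (hlaw e).aemeasurable.sub_const _
  have hsum : ∀ ω, (∑ e ∈ S, X e) ω = ∑ e ∈ S, Y e ω - ∑ e ∈ S, (q e : ℝ) := fun ω => by
    simp [hX]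
  have hmgf : ∀ z : ℝ, |z| ≤ 2 / 3 → mgf (∑ e ∈ S, X e) μ z ≤ Real.exp (3 / 4 * z ^ 2 * D) := by
    intro z hz
    rw [hXind.mgf_sum₀ hXm]
    calc ∏ e ∈ S, mgf (X e) μ z ≤ ∏ e ∈ S, Real.exp (3 / 4 * z ^ 2 * q e) := by
          refine Finset.prod_le_prod (fun _ _ => mgf_nonneg) fun e _ => ?_
          rw [mgf, hX, integral_comp_of_hasLaw_bernoulli (hlaw e)
            (f := fun x => Real.exp (z * (x - q e))) (by fun_prop)]
          exact bernoulli_mgf_le (q e).2 hz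
      _ = Real.exp (3 / 4 * z ^ 2 * ∑ e ∈ S, (q e : ℝ)) := by
          rw [← Real.exp_sum, Finset.mul_sum]
      _ ≤ _ := Real.exp_le_exp.2 (by gcongr)
  have hint : ∀ z : ℝ, Integrable (fun ω => Real.exp (z * (∑ e ∈ S, X e) ω)) μ := fun z => by
    simp only [Finset.sum_apply]
    have : ∀ ω, ∑ e ∈ S, X e ω = ∑ e : S, (Y e ω - q e) := fun ω => by
      rw [hX]; exact (Finset.sum_coe_sort S fun e => Y e ω - (q e : ℝ)).symm
    simp only [this]
    exact integrable_continuous_comp (Y := fun e : S => Y e) (fun e => (hlaw e).aemeasurable)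
      (fun e => ae_mem_Icc_of_hasLaw_bernoulli (hlaw e))
      (f := fun y => Real.exp (z * ∑ e : S, (y e - q e))) (by fun_prop)
  -- z = 2t/3 minimizes 3z²D/4 - ztD, with value -t²D/3. Only an upper bound D on the mean is used,
  -- so D may include the regularization.
  have hz : |2 * t / 3| ≤ 2 / 3 := by rw [abs_of_nonneg (by positivity)]; linarith
  have hup := measure_ge_le_exp_mul_mgf (μ := μ) (X := ∑ e ∈ S, X e) (t := 2 * t / 3) (t * D)
    (by positivity) (hint _)
  have hlo := measure_le_le_exp_mul_mgf (μ := μ) (X := ∑ e ∈ S, X e) (t := -(2 * t / 3))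
    (-(t * D)) (by linarith) (hint _)
  have hup' : Real.exp (-(2 * t / 3) * (t * D)) * mgf (∑ e ∈ S, X e) μ (2 * t / 3) ≤
      Real.exp (-(t ^ 2 * D / 3)) := by
    refine (mul_le_mul_of_nonneg_left (hmgf _ hz) (Real.exp_pos _).le).trans ?_
    rw [← Real.exp_add]
    exact Real.exp_le_exp.2 (by linarith)
  have hlo' : Real.exp (-(-(2 * t / 3)) * (-(t * D))) * mgf (∑ e ∈ S, X e) μ (-(2 * t / 3)) ≤
      Real.exp (-(t ^ 2 * D / 3)) := by
    refine (mul_le_mul_of_nonneg_left (hmgf _ (by rwa [abs_neg])) (Real.exp_pos _).le).trans ?_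
    rw [← Real.exp_add]
    exact Real.exp_le_exp.2 (by linarith)
  have hsub : {ω | t * D ≤ |∑ e ∈ S, Y e ω - ∑ e ∈ S, (q e : ℝ)|} ⊆
      {ω | t * D ≤ (∑ e ∈ S, X e) ω} ∪ {ω | (∑ e ∈ S, X e) ω ≤ -(t * D)} := by
    intro ω hω
    rw [Set.mem_ofPred_eq, ← hsum, le_abs'] at hω
    exact hω.symm
  have h := (measureReal_mono (μ := μ) hsub).trans (measureReal_union_le _ _)
  linarith

end Bernoulli

/-! ### Matrix Bernstein by dilation to the vertex space -/

section MatrixBernstein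

open Matrix NormedSpace

variable {I J : Type*} [Fintype I] [Fintype J] [DecidableEq I] [DecidableEq J]

/-- The vector `e_i + c e_j` indexed by the vertices of a bipartite graph. -/
def edgeVector (c : ℝ) (e : I × J) : I ⊕ J → ℝ :=
  Sum.elim (Pi.single e.1 1) (Pi.single e.2 c)

theorem edgeVector_dotProduct (c : ℝ) (e : I × J) (y : I → ℝ) (x : J → ℝ) :
    edgeVector c e ⬝ᵥ Sum.elim y x = y e.1 + c * x e.2 := by
  simp [edgeVector, sumElim_dotProduct_sumElim]

theorem edgeVector_dotProduct_edgeVector (c c' : ℝ) (e : I × J) :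
    edgeVector c e ⬝ᵥ edgeVector c' e = 1 + c * c' := by
  rw [edgeVector.eq_def c', edgeVector_dotProduct]
  simp

variable {Ω : Type*} [MeasurableSpace Ω] {μ : Measure Ω} [IsProbabilityMeasure μ]

/-- Matrix Bernstein inequality for a rectangular matrix with independent, weighted and centred
Bernoulli entries. -/
theorem measure_norm_gt_le {Y : I × J → Ω → ℝ} (hind : iIndepFun Y μ) {q : I × J → unitInterval}
    (hlaw : ∀ e, HasLaw (Y e) (bernoulliMeasure (1 : ℝ) 0 (q e)) μ) {a : I → J → ℝ} {R t : ℝ}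
    (ha : ∀ i j, 0 ≤ a i j) (haR : ∀ i j, a i j ≤ R) (hR : 0 < R)
    (hrow : ∀ i, ∑ j, (q (i, j) : ℝ) * a i j ^ 2 ≤ R)
    (hcol : ∀ j, ∑ i, (q (i, j) : ℝ) * a i j ^ 2 ≤ R) (ht0 : 0 < t) (ht1 : t ≤ 1) :
    μ.real {ω | ¬ ‖(Matrix.of fun i j => a i j * (Y (i, j) ω - q (i, j)) : Matrix I J ℝ)‖ ≤ t} ≤
      (Fintype.card I + Fintype.card J) * Real.exp (-(t ^ 2 / (3 * R))) := by
  -- This s maximizes st - 3s²R/4, with value t²/(3R).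
  obtain ⟨s, hs⟩ : ∃ s : ℝ, s = 2 * t / (3 * R) := ⟨_, rfl⟩
  have hs0 : 0 < s := by rw [hs]; positivity
  have hsR : s * R = 2 / 3 * t := by rw [hs]; field_simp
  obtain ⟨g, hg⟩ : ∃ g : I × J → ℝ, g = fun e => 3 / 4 * (s * a e.1 e.2) ^ 2 * q e := ⟨_, rfl⟩
  obtain ⟨z, hz⟩ : ∃ z : I × J → ℝ → ℝ, z = fun e x => s * a e.1 e.2 * (x - q e) := ⟨_, rfl⟩
  -- The half outer products of e_i ± e_j are orthogonal projections P₊, P₋. Their difference is the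
  -- symmetric dilation of the (i, j) matrix unit, and their sum is diagonal. The compensator g
  -- bounds the log-moment generating functions of z and -z, making the mean of exp(X) at most the
  -- identity.
  obtain ⟨X, hX⟩ : ∃ X : I × J → ℝ → Matrix (I ⊕ J) (I ⊕ J) ℝ, X = fun e x =>
    (z e x - g e) • halfOuter (edgeVector 1 e) + (-z e x - g e) • halfOuter (edgeVector (-1) e) :=
    ⟨_, rfl⟩
  have hzc : ∀ e, Continuous (z e) := fun e => by rw [hz]; fun_prop
  have hXc : ∀ e, Continuous (X e) := fun e => by
    rw [hX]
    exact (((hzc e).sub continuous_const).smul continuous_const).add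
      (((hzc e).neg.sub continuous_const).smul continuous_const)
  have hXs : ∀ e x, (X e x).IsSymm := fun e x => by
    rw [hX]
    exact ((halfOuter_isSymm _).smul _).add ((halfOuter_isSymm _).smul _)
  have hsmall : ∀ e : I × J, |s * a e.1 e.2| ≤ 2 / 3 := fun e => by
    rw [abs_of_nonneg (mul_nonneg hs0.le (ha _ _))]
    nlinarith [mul_le_mul_of_nonneg_left (haR e.1 e.2) hs0.le]
  have hexp1 : ∀ e, q e * Real.exp (z e 1 - g e) + (1 - q e) * Real.exp (z e 0 - g e) ≤ 1 := by
    intro e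
    have h := bernoulli_mgf_le (q e).2 (hsmall e)
    rw [Real.exp_sub, Real.exp_sub, ← mul_div_assoc, ← mul_div_assoc, ← add_div,
      div_le_one (Real.exp_pos _), hz, hg]
    exact h
  have hexp2 : ∀ e, q e * Real.exp (-z e 1 - g e) + (1 - q e) * Real.exp (-z e 0 - g e) ≤ 1 := by
    intro e
    have h := bernoulli_mgf_le (q e).2 (z := -(s * a e.1 e.2)) (by rw [abs_neg]; exact hsmall e)
    rw [neg_sq, neg_mul, neg_mul] at h
    rw [Real.exp_sub, Real.exp_sub, ← mul_div_assoc, ← mul_div_assoc, ← add_div,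
      div_le_one (Real.exp_pos _), hz, hg]
    exact h
  have hstep : ∀ e, ∀ W : Matrix (I ⊕ J) (I ⊕ J) ℝ, W.PosSemidef →
      ∫ ω, (W * exp (X e (Y e ω))).trace ∂μ ≤ W.trace := by
    intro e W hW
    have hform : ∀ x, (W * exp (X e x)).trace = W.trace +
        (Real.exp (z e x - g e) - 1) * (W * halfOuter (edgeVector 1 e)).trace +
        (Real.exp (-z e x - g e) - 1) * (W * halfOuter (edgeVector (-1) e)).trace := by
      intro x
      rw [hX]
      simp only
      rw [exp_halfOuter_add (by rw [edgeVector_dotProduct_edgeVector]; norm_num)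
        (by rw [edgeVector_dotProduct_edgeVector]; norm_num)
        (by rw [edgeVector_dotProduct_edgeVector]; norm_num)]
      simp [Matrix.mul_add]
    rw [integral_comp_of_hasLaw_bernoulli (hlaw e) (f := fun x => (W * exp (X e x)).trace)
      (continuous_const.matrix_mul (continuous_matrix_exp.comp (hXc e))).matrix_trace]
    simp only [hform]
    have h1 := mul_le_mul_of_nonneg_right (hexp1 e)
      (trace_mul_halfOuter_nonneg hW (edgeVector 1 e))
    have h2 := mul_le_mul_of_nonneg_right (hexp2 e)
      (trace_mul_halfOuter_nonneg hW (edgeVector (-1) e))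
    linarith
  have hb := fun e => ae_mem_Icc_of_hasLaw_bernoulli (hlaw e)
  have hint := integral_trace_exp_sum_le hind (fun e => (hlaw e).aemeasurable) hb hXc hXs hstep
    Finset.univ
  have hsymm : ∀ ω, (∑ e, X e (Y e ω)).IsSymm := fun ω => by
    rw [IsSymm, transpose_sum]
    exact Finset.sum_congr rfl fun e _ => hXs e _
  have hintegrable : Integrable (fun ω => (exp (∑ e, X e (Y e ω))).trace) μ := by
    have hc : Continuous fun y : I × J → ℝ => exp (∑ e, X e (y e)) :=
      continuous_matrix_exp.comp (continuous_finsetSum _ fun e _ =>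
        (hXc e).comp (continuous_apply e))
    exact integrable_continuous_comp (fun e => (hlaw e).aemeasurable) hb hc.matrix_trace
  -- Summed over edges, the dilations give twice the bilinear form of the centred matrix, and the
  -- compensators give the row and column variances.
  have hquad : ∀ ω (y : I → ℝ) (x : J → ℝ), Sum.elim y x ⬝ᵥ (∑ e, X e (Y e ω)) *ᵥ Sum.elim y x =
      s * (2 * (y ⬝ᵥ (Matrix.of fun i j => a i j * (Y (i, j) ω - q (i, j)) : Matrix I J ℝ) *ᵥ x))
      - 3 / 4 * s ^ 2 * ((∑ i, y i ^ 2 * ∑ j, (q (i, j) : ℝ) * a i j ^ 2) +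
        ∑ j, x j ^ 2 * ∑ i, (q (i, j) : ℝ) * a i j ^ 2) := by
    intro ω y x
    rw [sum_mulVec, dotProduct_sum]
    have hterm : ∀ e, Sum.elim y x ⬝ᵥ X e (Y e ω) *ᵥ Sum.elim y x =
        s * (2 * (y e.1 * (a e.1 e.2 * (Y e ω - q e) * x e.2))) - 3 / 4 * s ^ 2 *
          (y e.1 ^ 2 * (q e * a e.1 e.2 ^ 2) + x e.2 ^ 2 * (q e * a e.1 e.2 ^ 2)) := fun e => by
      rw [hX]
      simp only
      rw [add_mulVec, smul_mulVec, smul_mulVec, dotProduct_add, dotProduct_smul, dotProduct_smul,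
        dotProduct_halfOuter_mulVec, dotProduct_halfOuter_mulVec, edgeVector_dotProduct,
        edgeVector_dotProduct, smul_eq_mul, smul_eq_mul, hz, hg]
      ring
    simp only [hterm]
    rw [Finset.sum_sub_distrib, ← Finset.mul_sum, ← Finset.mul_sum, ← Finset.mul_sum,
      Finset.sum_add_distrib]
    simp only [Fintype.sum_prod_type, dotProduct, mulVec, Finset.mul_sum, Matrix.of_apply]
    rw [Finset.sum_comm (f := fun j i => x j ^ 2 * ((q (i, j) : ℝ) * a i j ^ 2))]
  -- A norm above t yields a vector whose Rayleigh quotient exceeds st - 3s²R/4, forcing a large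
  -- trace exponential; Markov's inequality then applies.
  have hsub : {ω | ¬ ‖(Matrix.of fun i j => a i j * (Y (i, j) ω - q (i, j)) : Matrix I J ℝ)‖ ≤ t} ⊆
      {ω | Real.exp (t ^ 2 / (3 * R)) ≤ (exp (∑ e, X e (Y e ω))).trace} := by
    intro ω hω
    have hω' := mt (l2_opNorm_le_of_forall ht0) hω
    push Not at hω'
    obtain ⟨y, x, hyx⟩ := hω'
    refine exp_le_trace_exp_of_lt (hsymm ω) (v := Sum.elim y x) ?_
    rw [hquad, sumElim_dotProduct_sumElim]
    have h1 : ∑ i, y i ^ 2 * ∑ j, (q (i, j) : ℝ) * a i j ^ 2 ≤ R * (y ⬝ᵥ y) := by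
      rw [dotProduct, Finset.mul_sum]
      exact Finset.sum_le_sum fun i _ => by nlinarith [hrow i, sq_nonneg (y i)]
    have h2 : ∑ j, x j ^ 2 * ∑ i, (q (i, j) : ℝ) * a i j ^ 2 ≤ R * (x ⬝ᵥ x) := by
      rw [dotProduct, Finset.mul_sum]
      exact Finset.sum_le_sum fun j _ => by nlinarith [hcol j, sq_nonneg (x j)]
    have h3 : t ^ 2 / (3 * R) = s * t - 3 / 4 * s ^ 2 * R := by
      rw [hs]; field_simp; ring
    have h4 := mul_lt_mul_of_pos_left hyx hs0
    have h5 := mul_le_mul_of_nonneg_left (add_le_add h1 h2)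
      (by positivity : 0 ≤ 3 / 4 * s ^ 2)
    rw [h3]
    linarith
  have hmarkov := mul_meas_ge_le_integral_of_nonneg (μ := μ)
    (f := fun ω => (exp (∑ e, X e (Y e ω))).trace)
    (Filter.Eventually.of_forall fun ω => (posSemidef_exp (hsymm ω)).trace_nonneg) hintegrable
    (Real.exp (t ^ 2 / (3 * R)))
  rw [Fintype.card_sum, Nat.cast_add] at hint
  rw [Real.exp_neg, ← div_eq_mul_inv, le_div_iff₀ (Real.exp_pos _)]
  calc _ ≤ _ := mul_le_mul_of_nonneg_right (measureReal_mono hsub) (Real.exp_pos _).le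
    _ ≤ _ := by rw [mul_comm]; exact hmarkov.trans hint

end MatrixBernstein

/-! ### Deterministic perturbation of normalized matrices -/

section Deterministic

variable {n p : ℕ} {lw lf : ℝ} {A B : Matrix (Fin n) (Fin p) ℝ}

theorem normalized_apply (lw lf : ℝ) (B : Matrix (Fin n) (Fin p) ℝ) (i : Fin n) (j : Fin p) :
    normalized lw lf B i j =
      (√(workerDegree B i + lw))⁻¹ * B i j * (√(firmDegree B j + lf))⁻¹ := by
  simp [normalized, workerScaling, firmScaling, Matrix.mul_diagonal, Matrix.diagonal_mul]

/-- A Schur test: with scalings u and v, 2uv|y||x| ≤ u²y² + v²x², and summing against B leaves row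
and column sums that the scalings make at most 1. -/
theorem norm_le_of_abs_le_normalized (hB : ∀ i j, 0 ≤ B i j) (hlw : 0 ≤ lw) (hlf : 0 ≤ lf)
    (hwd : WellDefined lw lf B) {F : Matrix (Fin n) (Fin p) ℝ} {c : ℝ} (hc : 0 < c)
    (hF : ∀ i j, |F i j| ≤ c * normalized lw lf B i j) : ‖F‖ ≤ c := by
  refine l2_opNorm_le_of_forall hc fun y x => ?_
  have hu : ∀ i, (√(workerDegree B i + lw))⁻¹ ^ 2 * ∑ j, B i j ≤ 1 := fun i => by
    rw [inv_pow, Real.sq_sqrt (hwd.1 i).le, inv_mul_le_iff₀ (hwd.1 i), mul_one]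
    exact le_add_of_nonneg_right hlw
  have hv : ∀ j, (√(firmDegree B j + lf))⁻¹ ^ 2 * ∑ i, B i j ≤ 1 := fun j => by
    rw [inv_pow, Real.sq_sqrt (hwd.2 j).le, inv_mul_le_iff₀ (hwd.2 j), mul_one]
    exact le_add_of_nonneg_right hlf
  have hterm : ∀ i j, 2 * (y i * (F i j * x j)) ≤
      c * (y i ^ 2 * ((√(workerDegree B i + lw))⁻¹ ^ 2 * B i j) +
        x j ^ 2 * ((√(firmDegree B j + lf))⁻¹ ^ 2 * B i j)) := by
    intro i j
    have h := hF i j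
    rw [normalized_apply] at h
    have h1 : y i * (F i j * x j) ≤ |F i j| * |y i * x j| := by
      rw [← abs_mul]
      exact (le_of_eq (by ring)).trans (le_abs_self _)
    have h2 := mul_le_mul_of_nonneg_right h (abs_nonneg (y i * x j))
    generalize (√(workerDegree B i + lw))⁻¹ = u at *
    generalize (√(firmDegree B j + lf))⁻¹ = v at *
    rw [abs_mul] at h1 h2
    have h3 : 0 ≤ c * B i j * (u * |y i| - v * |x j|) ^ 2 :=
      mul_nonneg (mul_nonneg hc.le (hB i j)) (sq_nonneg _)
    have h4 : c * B i j * (u * |y i| - v * |x j|) ^ 2 =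
        c * (|y i| ^ 2 * (u ^ 2 * B i j) + |x j| ^ 2 * (v ^ 2 * B i j)) -
          2 * (c * (u * B i j * v) * (|y i| * |x j|)) := by ring
    rw [sq_abs, sq_abs] at h4
    linarith
  calc 2 * (y ⬝ᵥ F *ᵥ x) = ∑ i, ∑ j, 2 * (y i * (F i j * x j)) := by
        simp only [dotProduct, Matrix.mulVec, Finset.mul_sum]
    _ ≤ ∑ i, ∑ j, c * (y i ^ 2 * ((√(workerDegree B i + lw))⁻¹ ^ 2 * B i j) +
        x j ^ 2 * ((√(firmDegree B j + lf))⁻¹ ^ 2 * B i j)) :=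
        Finset.sum_le_sum fun i _ => Finset.sum_le_sum fun j _ => hterm i j
    _ = c * (∑ i, y i ^ 2 * ((√(workerDegree B i + lw))⁻¹ ^ 2 * ∑ j, B i j) +
        ∑ j, x j ^ 2 * ((√(firmDegree B j + lf))⁻¹ ^ 2 * ∑ i, B i j)) := by
        simp only [← Finset.mul_sum, Finset.sum_add_distrib]
        rw [Finset.sum_comm (f := fun i j => x j ^ 2 * ((√(firmDegree B j + lf))⁻¹ ^ 2 * B i j))]
        simp only [← Finset.mul_sum]
    _ ≤ c * (y ⬝ᵥ y + x ⬝ᵥ x) := by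
        refine mul_le_mul_of_nonneg_left (add_le_add ?_ ?_) hc.le
        · exact Finset.sum_le_sum fun i _ => by nlinarith [hu i, sq_nonneg (y i)]
        · exact Finset.sum_le_sum fun j _ => by nlinarith [hv j, sq_nonneg (x j)]

theorem normalized_nonneg (hB : ∀ i j, 0 ≤ B i j) (i : Fin n) (j : Fin p) :
    0 ≤ normalized lw lf B i j := by
  rw [normalized_apply]
  have := hB i j
  positivity

theorem norm_normalized_le_one (hB : ∀ i j, 0 ≤ B i j) (hlw : 0 ≤ lw) (hlf : 0 ≤ lf)
    (hwd : WellDefined lw lf B) : ‖normalized lw lf B‖ ≤ 1 :=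
  norm_le_of_abs_le_normalized hB hlw hlf hwd one_pos fun i j => by
    rw [abs_of_nonneg (normalized_nonneg hB i j), one_mul]

/-- The geometric means r = √(ab) and r' = √(a'b') satisfy |r - r'| ≤ tr'; dividing by rr' gives an
error relative to 1/r. Measuring against the perturbed scaling avoids a factor 1/(1 - t). -/
theorem abs_inv_sqrt_mul_sub_le {a a' b b' t : ℝ} (ha : 0 < a) (ha' : 0 < a') (hb : 0 < b)
    (hb' : 0 < b') (ht0 : 0 ≤ t) (ht1 : t ≤ 1) (haa : |a - a'| ≤ t * a')
    (hbb : |b - b'| ≤ t * b') :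
    |(√a)⁻¹ * (√b)⁻¹ - (√a')⁻¹ * (√b')⁻¹| ≤ t * ((√a)⁻¹ * (√b)⁻¹) := by
  rw [abs_le] at haa hbb
  have e : ∀ x y : ℝ, 0 < x → (√x)⁻¹ * (√y)⁻¹ = (√(x * y))⁻¹ := fun x y hx => by
    rw [Real.sqrt_mul hx.le, mul_inv]
  have hup : √(a * b) ≤ (1 + t) * √(a' * b') := by
    rw [Real.sqrt_le_left (by positivity), mul_pow, Real.sq_sqrt (by positivity)]
    calc a * b ≤ ((1 + t) * a') * ((1 + t) * b') :=
          mul_le_mul (by linarith) (by linarith) hb.le (by positivity)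
      _ = _ := by ring
  have hlo : (1 - t) * √(a' * b') ≤ √(a * b) := by
    refine Real.le_sqrt_of_sq_le ?_
    rw [mul_pow, Real.sq_sqrt (by positivity)]
    calc (1 - t) ^ 2 * (a' * b') = ((1 - t) * a') * ((1 - t) * b') := by ring
      _ ≤ a * b := mul_le_mul (by linarith) (by linarith)
          (mul_nonneg (by linarith) hb'.le) ha.le
  rw [e a b ha, e a' b' ha']
  have h1 : 0 < √(a * b) := Real.sqrt_pos.2 (by positivity)
  have h2 : 0 < √(a' * b') := Real.sqrt_pos.2 (by positivity)
  generalize √(a * b) = r at *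
  generalize √(a' * b') = r' at *
  have h3 : r⁻¹ - r'⁻¹ = (r' - r) * (r⁻¹ * r'⁻¹) := by field_simp
  have h4 : t * r⁻¹ = t * r' * (r⁻¹ * r'⁻¹) := by field_simp
  rw [h3, h4, abs_mul, abs_of_pos (by positivity : 0 < r⁻¹ * r'⁻¹)]
  refine mul_le_mul_of_nonneg_right ?_ (by positivity)
  rw [abs_le]
  constructor <;> linarith

theorem norm_normalized_sub_le (hB : ∀ i j, 0 ≤ B i j) (hlw : 0 ≤ lw) (hlf : 0 ≤ lf)
    (hwdA : WellDefined lw lf A) (hwd : WellDefined lw lf B) {t : ℝ} (ht0 : 0 < t) (ht1 : t ≤ 1)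
    (hw : ∀ i, |workerDegree B i - workerDegree A i| ≤ t * (workerDegree A i + lw))
    (hf : ∀ j, |firmDegree B j - firmDegree A j| ≤ t * (firmDegree A j + lf))
    (hZ : ‖(Matrix.of fun i j => (√(workerDegree A i + lw))⁻¹ * (√(firmDegree A j + lf))⁻¹ *
      (B i j - A i j) : Matrix (Fin n) (Fin p) ℝ)‖ ≤ t) :
    ‖normalized lw lf B - normalized lw lf A‖ ≤ 2 * t := by
  -- First the change of scaling, dominated by t times the normalized B; then the centred matrix
  -- with the scalings of A.
  have hdec : normalized lw lf B - normalized lw lf A =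
      (Matrix.of fun i j => ((√(workerDegree B i + lw))⁻¹ * (√(firmDegree B j + lf))⁻¹ -
        (√(workerDegree A i + lw))⁻¹ * (√(firmDegree A j + lf))⁻¹) * B i j) +
      Matrix.of fun i j => (√(workerDegree A i + lw))⁻¹ * (√(firmDegree A j + lf))⁻¹ *
        (B i j - A i j) := by
    ext i j
    simp only [Matrix.sub_apply, Matrix.add_apply, Matrix.of_apply, normalized_apply]
    ring
  rw [hdec, two_mul]
  refine (norm_add_le _ _).trans (add_le_add ?_ hZ)
  refine norm_le_of_abs_le_normalized hB hlw hlf hwd ht0 fun i j => ?_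
  rw [Matrix.of_apply, abs_mul, abs_of_nonneg (hB i j), normalized_apply]
  have h := abs_inv_sqrt_mul_sub_le (hwd.1 i) (hwdA.1 i) (hwd.2 j) (hwdA.2 j) ht0.le ht1
    (by rw [add_sub_add_right_eq_sub]; exact hw i)
    (by rw [add_sub_add_right_eq_sub]; exact hf j)
  calc _ ≤ _ := mul_le_mul_of_nonneg_right h (hB i j)
    _ = _ := by ring

theorem norm_transpose_eq {I J : Type*} [Fintype I] [Fintype J] [DecidableEq I] [DecidableEq J]
    (F : Matrix I J ℝ) : ‖Fᵀ‖ = ‖F‖ := by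
  rw [← Matrix.conjTranspose_eq_transpose_of_trivial, Matrix.l2_opNorm_conjTranspose]

theorem norm_mul_transpose_sub_le {I J : Type*} [Fintype I] [Fintype J] [DecidableEq I]
    [DecidableEq J] {E F : Matrix I J ℝ} (hE : ‖E‖ ≤ 1) (hF : ‖F‖ ≤ 1) :
    ‖E * Eᵀ - F * Fᵀ‖ ≤ 2 * ‖E - F‖ := by
  have h : E * Eᵀ - F * Fᵀ = E * (E - F)ᵀ + (E - F) * Fᵀ := by
    rw [Matrix.transpose_sub, Matrix.mul_sub, Matrix.sub_mul]; abel
  have h1 := Matrix.l2_opNorm_mul E (E - F)ᵀ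
  have h2 := Matrix.l2_opNorm_mul (E - F) Fᵀ
  rw [norm_transpose_eq] at h1 h2
  rw [h]
  have h3 := mul_le_mul_of_nonneg_right hE (norm_nonneg (E - F))
  have h4 := mul_le_mul_of_nonneg_left hF (norm_nonneg (E - F))
  have h5 := norm_add_le (E * (E - F)ᵀ) ((E - F) * Fᵀ)
  linarith

theorem norm_workerLaplacian_sub_le (hA : ‖normalized lw lf A‖ ≤ 1)
    (hB : ‖normalized lw lf B‖ ≤ 1) : ‖workerLaplacian lw lf B - workerLaplacian lw lf A‖ ≤
      2 * ‖normalized lw lf B - normalized lw lf A‖ := by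
  rw [workerLaplacian, workerLaplacian, sub_sub_sub_cancel_left, norm_sub_rev]
  exact norm_mul_transpose_sub_le hB hA

theorem norm_firmLaplacian_sub_le (hA : ‖normalized lw lf A‖ ≤ 1)
    (hB : ‖normalized lw lf B‖ ≤ 1) : ‖firmLaplacian lw lf B - firmLaplacian lw lf A‖ ≤
      2 * ‖normalized lw lf B - normalized lw lf A‖ := by
  have h := norm_mul_transpose_sub_le (E := (normalized lw lf B)ᵀ) (F := (normalized lw lf A)ᵀ)
    ((norm_transpose_eq _).trans_le hB) ((norm_transpose_eq _).trans_le hA)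
  rw [← Matrix.transpose_sub, norm_transpose_eq, Matrix.transpose_transpose,
    Matrix.transpose_transpose] at h
  rw [firmLaplacian, firmLaplacian, sub_sub_sub_cancel_left, norm_sub_rev]
  exact h

end Deterministic

/-! ### Expected degrees and concentration in the block model -/

namespace BlockModel

variable {n p K : ℕ} (m : BlockModel n p K)

theorem minWorkerDegree_le (i : Fin n) :
    m.minWorkerDegree ≤ workerDegree m.expectedMatrix i := by
  have h : workerDegree m.expectedMatrix i =
      1 / (m.typeCount (m.workerType i) : ℝ) * ∑ l, m.C (m.workerType i) l := by
    simp only [workerDegree, expectedMatrix]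
    -- Grouping firms by type lets the θ's sum to one in each group.
    rw [← Finset.sum_fiberwise Finset.univ m.firmType, Finset.mul_sum]
    refine Finset.sum_congr rfl fun l _ => ?_
    have : ∀ j ∈ Finset.univ.filter fun j => m.firmType j = l,
        1 / (m.typeCount (m.workerType i) : ℝ) * m.θ j * m.C (m.workerType i) (m.firmType j) =
        m.θ j * (1 / (m.typeCount (m.workerType i) : ℝ) * m.C (m.workerType i) l) := fun j hj => by
      rw [(Finset.mem_filter.1 hj).2]; ring
    rw [Finset.sum_congr rfl this, ← Finset.sum_mul, m.θ_sum, one_mul]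
  rw [h]
  exact ciInf_le (Set.finite_range _).bddBelow (m.workerType i)

theorem minFirmDegree_le (j : Fin p) : m.minFirmDegree ≤ firmDegree m.expectedMatrix j := by
  have h : firmDegree m.expectedMatrix j = m.θ j * ∑ k, m.C k (m.firmType j) := by
    simp only [firmDegree, expectedMatrix]
    rw [← Finset.sum_fiberwise Finset.univ m.workerType, Finset.mul_sum]
    refine Finset.sum_congr rfl fun k _ => ?_
    have hc : (m.typeCount k : ℝ) ≠ 0 := by
      obtain ⟨i, hi⟩ := m.workerType_surjective k
      rw [Nat.cast_ne_zero, typeCount, Finset.card_ne_zero]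
      exact ⟨i, by simp [hi]⟩
    have : ∀ i ∈ Finset.univ.filter fun i => m.workerType i = k,
        1 / (m.typeCount (m.workerType i) : ℝ) * m.θ j * m.C (m.workerType i) (m.firmType j) =
        1 / (m.typeCount k : ℝ) * m.θ j * m.C k (m.firmType j) := fun i hi => by
      rw [(Finset.mem_filter.1 hi).2]
    rw [Finset.sum_congr rfl this, Finset.sum_const, ← typeCount, nsmul_eq_mul]
    field_simp
  rw [h]
  exact ciInf_le (Set.finite_range _).bddBelow j

end BlockModel

namespace BlockModel

variable {n p K : ℕ} {m : BlockModel n p K} {Ω : Type*} [MeasurableSpace Ω] {μ : Measure Ω}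
  {B : Ω → Matrix (Fin n) (Fin p) ℝ}

theorem IsNetwork.ae_nonneg (hB : m.IsNetwork μ B) : ∀ᵐ ω ∂μ, ∀ i j, 0 ≤ B ω i j := by
  rw [ae_all_iff]
  intro i
  rw [ae_all_iff]
  intro j
  filter_upwards [ae_mem_Icc_of_hasLaw_bernoulli (hB.law i j)] with ω hω using hω.1

variable [IsProbabilityMeasure μ]

theorem IsNetwork.measure_workerDegree_le (hB : m.IsNetwork μ B) (i : Fin n) {lw t : ℝ}
    (hlw : 0 ≤ lw) (ht0 : 0 ≤ t) (ht1 : t ≤ 1) :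
    μ.real {ω | t * (workerDegree m.expectedMatrix i + lw) ≤
      |workerDegree (B ω) i - workerDegree m.expectedMatrix i|} ≤
      2 * Real.exp (-(t ^ 2 * (workerDegree m.expectedMatrix i + lw) / 3)) := by
  have h := measure_abs_sum_sub_ge_le hB.indep (fun e : Fin n × Fin p => hB.law e.1 e.2)
    ({i} ×ˢ Finset.univ) (D := workerDegree m.expectedMatrix i + lw) (t := t)
    (by simp [workerDegree, hlw]) ht0 ht1
  simpa [Finset.sum_product, workerDegree] using h

theorem IsNetwork.measure_firmDegree_le (hB : m.IsNetwork μ B) (j : Fin p) {lf t : ℝ}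
    (hlf : 0 ≤ lf) (ht0 : 0 ≤ t) (ht1 : t ≤ 1) :
    μ.real {ω | t * (firmDegree m.expectedMatrix j + lf) ≤
      |firmDegree (B ω) j - firmDegree m.expectedMatrix j|} ≤
      2 * Real.exp (-(t ^ 2 * (firmDegree m.expectedMatrix j + lf) / 3)) := by
  have h := measure_abs_sum_sub_ge_le hB.indep (fun e : Fin n × Fin p => hB.law e.1 e.2)
    (Finset.univ ×ˢ {j}) (D := firmDegree m.expectedMatrix j + lf) (t := t)
    (by simp [firmDegree, hlf]) ht0 ht1
  simpa [Finset.sum_product, firmDegree] using h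

theorem IsNetwork.measure_norm_gt_le (hB : m.IsNetwork μ B) {lw lf M t : ℝ} (hlw : 0 ≤ lw)
    (hlf : 0 ≤ lf) (hM : 0 < M) (hwd : WellDefined lw lf m.expectedMatrix)
    (hMw : ∀ i, (workerDegree m.expectedMatrix i + lw)⁻¹ ≤ M)
    (hMf : ∀ j, (firmDegree m.expectedMatrix j + lf)⁻¹ ≤ M) (ht0 : 0 < t) (ht1 : t ≤ 1) :
    μ.real {ω | ¬ ‖(Matrix.of fun i j => (√(workerDegree m.expectedMatrix i + lw))⁻¹ *
      (√(firmDegree m.expectedMatrix j + lf))⁻¹ * (B ω i j - m.expectedMatrix i j) :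
        Matrix (Fin n) (Fin p) ℝ)‖ ≤ t} ≤ ((n : ℝ) + p) * Real.exp (-(t ^ 2 / (3 * M))) := by
  obtain ⟨u, hu⟩ : ∃ u : Fin n → ℝ, u = fun i => (√(workerDegree m.expectedMatrix i + lw))⁻¹ :=
    ⟨_, rfl⟩
  obtain ⟨v, hv⟩ : ∃ v : Fin p → ℝ, v = fun j => (√(firmDegree m.expectedMatrix j + lf))⁻¹ :=
    ⟨_, rfl⟩
  have hu2 : ∀ i, u i ^ 2 = (workerDegree m.expectedMatrix i + lw)⁻¹ := fun i => by
    rw [hu, inv_pow, Real.sq_sqrt (hwd.1 i).le]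
  have hv2 : ∀ j, v j ^ 2 = (firmDegree m.expectedMatrix j + lf)⁻¹ := fun j => by
    rw [hv, inv_pow, Real.sq_sqrt (hwd.2 j).le]
  have hu0 : ∀ i, 0 ≤ u i := fun i => by rw [hu]; positivity
  have hv0 : ∀ j, 0 ≤ v j := fun j => by rw [hv]; positivity
  have hq0 : ∀ i j, 0 ≤ m.expectedMatrix i j := fun i j => (m.expectedMatrix_mem i j).1
  have hudeg : ∀ i, u i ^ 2 * ∑ j, m.expectedMatrix i j ≤ 1 := fun i => by
    rw [hu2, inv_mul_le_iff₀ (hwd.1 i), mul_one]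
    exact le_add_of_nonneg_right hlw
  have hvdeg : ∀ j, v j ^ 2 * ∑ i, m.expectedMatrix i j ≤ 1 := fun j => by
    rw [hv2, inv_mul_le_iff₀ (hwd.2 j), mul_one]
    exact le_add_of_nonneg_right hlf
  -- R = M serves every bound: u_i v_j ≤ (u_i² + v_j²)/2 ≤ M, and each variance sum takes M from one
  -- squared scaling while the other normalizes a degree to at most 1.
  have h := BipartiteSBM.measure_norm_gt_le hB.indep (fun e : Fin n × Fin p => hB.law e.1 e.2)
    (a := fun i j => u i * v j) (R := M) (t := t) (fun i j => mul_nonneg (hu0 i) (hv0 j))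
    (fun i j => ?_) hM (fun i => ?_) (fun j => ?_) ht0 ht1
  · rw [Fintype.card_fin, Fintype.card_fin] at h
    rw [hu, hv] at h
    exact h
  · have h1 := (hu2 i).trans_le (hMw i)
    have h2 := (hv2 j).trans_le (hMf j)
    nlinarith [sq_nonneg (u i - v j)]
  · calc ∑ j, m.expectedMatrix i j * (u i * v j) ^ 2
        ≤ ∑ j, M * (u i ^ 2 * m.expectedMatrix i j) := Finset.sum_le_sum fun j _ => by
          have h1 := mul_le_mul_of_nonneg_right ((hv2 j).trans_le (hMf j))
            (mul_nonneg (sq_nonneg (u i)) (hq0 i j))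
          linarith
      _ = M * (u i ^ 2 * ∑ j, m.expectedMatrix i j) := by simp only [Finset.mul_sum]
      _ ≤ M := mul_le_of_le_one_right hM.le (hudeg i)
  · calc ∑ i, m.expectedMatrix i j * (u i * v j) ^ 2
        ≤ ∑ i, M * (v j ^ 2 * m.expectedMatrix i j) := Finset.sum_le_sum fun i _ => by
          have h1 := mul_le_mul_of_nonneg_right ((hu2 i).trans_le (hMw i))
            (mul_nonneg (sq_nonneg (v j)) (hq0 i j))
          linarith
      _ = M * (v j ^ 2 * ∑ i, m.expectedMatrix i j) := by simp only [Finset.mul_sum]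
      _ ≤ M := mul_le_of_le_one_right hM.le (hvdeg j)

end BlockModel

theorem one_sub_le_measureReal_of_compl_le {Ω : Type*} [MeasurableSpace Ω] {μ : Measure Ω}
    [IsProbabilityMeasure μ] {s : Set Ω} {c : ℝ} (h : μ.real sᶜ ≤ c) : 1 - c ≤ μ.real s := by
  have h1 := measureReal_union_le (μ := μ) s sᶜ
  rw [Set.union_compl_self, probReal_univ] at h1
  linarith

end BipartiteSBM

/-! ### Union bound and conclusion -/

open BipartiteSBM

theorem mainTheorem1 {n p K : ℕ} (hn : 0 < n) (m : BipartiteSBM.BlockModel n p K)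
    {Ω : Type*} [MeasurableSpace Ω] (μ : Measure Ω) [IsProbabilityMeasure μ]
    (B : Ω → Matrix (Fin n) (Fin p) ℝ) (hB : m.IsNetwork μ B)
    (lw lf : ℝ) (hlw : 0 ≤ lw) (hlf : 0 ≤ lf)
    (hw : 0 < m.minWorkerDegree + lw) (hf : 0 < m.minFirmDegree + lf)
    (ε : ℝ) (hε : 0 < ε) (γ M t : ℝ)
    (hγ : γ = (p : ℝ) / (n : ℝ))
    (hM : M = max (m.minWorkerDegree + lw)⁻¹ (m.minFirmDegree + lf)⁻¹)
    (ht : t = √(3 * M * Real.log (((n : ℝ) + (p : ℝ)) / ε)))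
    (hMle : M ≤ (3 * Real.log (((n : ℝ) + (p : ℝ)) / ε))⁻¹) :
    t ≤ 1 ∧
    1 - (3 + 4 * γ) / (1 + γ) * ε ≤ μ.real {ω |
      BipartiteSBM.WellDefined lw lf (B ω) ∧
      ‖BipartiteSBM.normalized lw lf (B ω) -
          BipartiteSBM.normalized lw lf m.expectedMatrix‖ ≤ 4 * t ∧
      ‖BipartiteSBM.workerLaplacian lw lf (B ω) -
          BipartiteSBM.workerLaplacian lw lf m.expectedMatrix‖ ≤ 8 * t ∧
      ‖BipartiteSBM.firmLaplacian lw lf (B ω) -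
          BipartiteSBM.firmLaplacian lw lf m.expectedMatrix‖ ≤ 8 * t} := by
  have hN : 0 < (n : ℝ) + p := by positivity
  have hM0 : 0 < M := by rw [hM]; exact lt_max_of_lt_left (inv_pos.2 hw)
  obtain ⟨L, hL⟩ : ∃ L, L = Real.log (((n : ℝ) + (p : ℝ)) / ε) := ⟨_, rfl⟩
  rw [← hL] at ht hMle
  -- Positivity of M forces (3L)⁻¹ > 0, so the bound on M implicitly gives ε < n + p.
  have hL0 : 0 < L := by
    have := inv_pos.1 (hM0.trans_le hMle)
    linarith
  have hexpL : Real.exp (-L) = ε / ((n : ℝ) + p) := by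
    rw [hL, Real.exp_neg, Real.exp_log (by positivity), inv_div]
  have htsq : t ^ 2 = 3 * M * L := by rw [ht, Real.sq_sqrt (by positivity)]
  have ht0 : 0 < t := by rw [ht]; exact Real.sqrt_pos.2 (by positivity)
  have ht1 : t ≤ 1 := by
    rw [ht, Real.sqrt_le_one]
    have := mul_le_mul_of_nonneg_right hMle (by positivity : 0 ≤ 3 * L)
    rw [inv_mul_cancel₀ (by positivity)] at this
    linarith
  refine ⟨ht1, ?_⟩
  have hwdeg : ∀ i, m.minWorkerDegree + lw ≤ workerDegree m.expectedMatrix i + lw := fun i =>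
    add_le_add_left (m.minWorkerDegree_le i) lw
  have hfdeg : ∀ j, m.minFirmDegree + lf ≤ firmDegree m.expectedMatrix j + lf := fun j =>
    add_le_add_left (m.minFirmDegree_le j) lf
  have hwdA : WellDefined lw lf m.expectedMatrix :=
    ⟨fun i => hw.trans_le (hwdeg i), fun j => hf.trans_le (hfdeg j)⟩
  have hMw : ∀ i, (workerDegree m.expectedMatrix i + lw)⁻¹ ≤ M := fun i =>
    (inv_anti₀ hw (hwdeg i)).trans (hM ▸ le_max_left _ _)
  have hMf : ∀ j, (firmDegree m.expectedMatrix j + lf)⁻¹ ≤ M := fun j =>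
    (inv_anti₀ hf (hfdeg j)).trans (hM ▸ le_max_right _ _)
  -- Since t² = 3ML and MD ≥ 1, the exponent is -MLD ≤ -L.
  have htail : ∀ D : ℝ, 0 < D → D⁻¹ ≤ M →
      2 * Real.exp (-(t ^ 2 * D / 3)) ≤ 2 * (ε / ((n : ℝ) + p)) := fun D hD hDM => by
    rw [← hexpL, htsq]
    gcongr
    rw [inv_le_iff_one_le_mul₀ hD] at hDM
    nlinarith
  obtain ⟨W, hW⟩ : ∃ W : Fin n → Set Ω, W = fun i =>
    {ω | t * (workerDegree m.expectedMatrix i + lw) ≤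
      |workerDegree (B ω) i - workerDegree m.expectedMatrix i|} := ⟨_, rfl⟩
  obtain ⟨F, hF⟩ : ∃ F : Fin p → Set Ω, F = fun j =>
    {ω | t * (firmDegree m.expectedMatrix j + lf) ≤
      |firmDegree (B ω) j - firmDegree m.expectedMatrix j|} := ⟨_, rfl⟩
  obtain ⟨Z, hZ⟩ : ∃ Z : Set Ω, Z =
    {ω | ¬ ‖(Matrix.of fun i j => (√(workerDegree m.expectedMatrix i + lw))⁻¹ *
      (√(firmDegree m.expectedMatrix j + lf))⁻¹ * (B ω i j - m.expectedMatrix i j) :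
        Matrix (Fin n) (Fin p) ℝ)‖ ≤ t} := ⟨_, rfl⟩
  -- Entries are nonnegative only almost surely; this null set collects the exceptions.
  obtain ⟨N, hNset⟩ : ∃ N : Set Ω, N = {ω | ¬ ∀ i j, 0 ≤ B ω i j} := ⟨_, rfl⟩
  have hμW : ∀ i, μ.real (W i) ≤ 2 * (ε / ((n : ℝ) + p)) := fun i => by
    rw [hW]
    exact (hB.measure_workerDegree_le i hlw ht0.le ht1).trans (htail _ (hwdA.1 i) (hMw i))
  have hμF : ∀ j, μ.real (F j) ≤ 2 * (ε / ((n : ℝ) + p)) := fun j => by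
    rw [hF]
    exact (hB.measure_firmDegree_le j hlf ht0.le ht1).trans (htail _ (hwdA.2 j) (hMf j))
  have hμZ : μ.real Z ≤ ε := by
    rw [hZ]
    refine (hB.measure_norm_gt_le hlw hlf hM0 hwdA hMw hMf ht0 ht1).trans_eq ?_
    rw [htsq, mul_div_cancel_left₀ _ (by positivity), hexpL, mul_div_cancel₀ _ hN.ne']
  have hμN : μ.real N = 0 := by
    rw [hNset, measureReal_def, ae_iff.1 hB.ae_nonneg, ENNReal.toReal_zero]
  have hbad : μ.real ((⋃ i, W i) ∪ (⋃ j, F j) ∪ Z ∪ N) ≤ 3 * ε := by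
    have h1 := measureReal_union_le (μ := μ) ((⋃ i, W i) ∪ (⋃ j, F j) ∪ Z) N
    have h2 := measureReal_union_le (μ := μ) ((⋃ i, W i) ∪ (⋃ j, F j)) Z
    have h3 := measureReal_union_le (μ := μ) (⋃ i, W i) (⋃ j, F j)
    have h4 : μ.real (⋃ i, W i) ≤ n * (2 * (ε / ((n : ℝ) + p))) :=
      (measureReal_iUnion_fintype_le W).trans
        ((Finset.sum_le_sum fun i _ => hμW i).trans_eq (by simp))
    have h5 : μ.real (⋃ j, F j) ≤ p * (2 * (ε / ((n : ℝ) + p))) :=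
      (measureReal_iUnion_fintype_le F).trans
        ((Finset.sum_le_sum fun j _ => hμF j).trans_eq (by simp))
    have h6 : (n : ℝ) * (2 * (ε / ((n : ℝ) + p))) + p * (2 * (ε / ((n : ℝ) + p))) = 2 * ε := by
      field_simp
    linarith
  -- The stated loss is weaker than 3ε because 3(1 + γ) ≤ 3 + 4γ.
  have hγε : 3 * ε ≤ (3 + 4 * γ) / (1 + γ) * ε := by
    have hγ0 : 0 ≤ γ := by rw [hγ]; positivity
    refine mul_le_mul_of_nonneg_right ?_ hε.le
    rw [le_div_iff₀ (by positivity)]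
    linarith
  refine one_sub_le_measureReal_of_compl_le (le_trans (measureReal_mono ?_) (hbad.trans hγε))
  intro ω hω
  by_contra hgood
  apply hω
  simp only [Set.mem_union, Set.mem_iUnion, not_or, not_exists] at hgood
  obtain ⟨⟨⟨hgW, hgF⟩, hgZ⟩, hgN⟩ := hgood
  rw [hW] at hgW
  rw [hF] at hgF
  rw [hZ, Set.mem_ofPred_eq, not_not] at hgZ
  rw [hNset, Set.mem_ofPred_eq, not_not] at hgN
  simp only [Set.mem_ofPred_eq, not_le] at hgW hgF
  -- The degree deviations are strict, so positivity survives even at t = 1.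
  have hwd : WellDefined lw lf (B ω) := by
    refine ⟨fun i => ?_, fun j => ?_⟩
    · have h1 := (abs_lt.1 (hgW i)).1
      nlinarith [mul_le_of_le_one_left (hwdA.1 i).le ht1]
    · have h1 := (abs_lt.1 (hgF j)).1
      nlinarith [mul_le_of_le_one_left (hwdA.2 j).le ht1]
  have hE := norm_normalized_sub_le hgN hlw hlf hwdA hwd ht0 ht1 (fun i => (hgW i).le)
    (fun j => (hgF j).le) hgZ
  have hB1 := norm_normalized_le_one hgN hlw hlf hwd
  have hA1 := norm_normalized_le_one (fun i j => (m.expectedMatrix_mem i j).1) hlw hlf hwdA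
  refine ⟨hwd, by linarith, ?_, ?_⟩
  · linarith [norm_workerLaplacian_sub_le hA1 hB1]
  · linarith [norm_firmLaplacian_sub_le hA1 hB1]
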